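/- Let $M$ be a quasiminimal structure, i.e. an uncountable first-order structure in a countable language $L$ such that every subset of $M$ definable with parameters is countable or co-countable. Suppose that $\cdot$ is a group operation on $M$ that is definable in $M$ (with parameters). Let $\kappa$ be an infinite cardinal and let $\bar M$ be a $\kappa$-saturated elementary extension of $M$ (for example $\bar M$ saturated and $\kappa=|\bar M|$); a subset of $\bar M$ is called small if it has cardinality $<\kappa$. Then: (1) The formulas $\varphi(x)$ over $M$ that define co-countable subsets of $M$ form a complete type $p\in S_1(M)$ (the generic type of $M$). This $p$ is definable over $\emptyset$, i.e. for each $L$-formula $\varphi(x,\bar y)$ the set $\{\bar b\in M : \varphi(x,\bar b)\in p\}$ is $\emptyset$-definable in $M$. Moreover $p$ is left and right translation invariant: for all $g\in M$ and all formulas $\varphi(x)$ over $M$, $\varphi(x)\in p \iff \varphi(g\cdot x)\in p \iff \varphi(x\cdot g)\in p$. (2) $p$ has a unique heir $\bar p\in S_1(\bar M)$. (A type $q\in S_1(\bar M)$ is an heir of $p$ if $q\supseteq p$ and, for every formula $\varphi(x,\bar y)$ over $M$, whenever $\varphi(x,\bar c)\in q$ for some $\bar c$ in $\bar M$, there is $\bar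 b$ in $M$ with $\varphi(x,\bar b)\in p$.) (3) The formula that defines $\cdot$ in $M$ defines a group operation on all of $\bar M$, and with it $\bar M$ is a regular group, witnessed by $\bar p$; that is, $(\bar p(x),x=x)$ is strongly regular: no formula of $\bar p$ has only finitely many solutions, and there is a small $A\subseteq\bar M$ such that $\bar p$ is invariant under all automorphisms of $\bar M$ fixing $A$ pointwise and, for every $B$ with $A\subseteq B\subseteq\bar M$ and every $a\in\bar M$, either $a\models \bar p|B$ or $\bar p|B\vdash \bar p|(B\cup\{a\})$ (entailment modulo the elementary diagram of $\bar M$). -/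

import Mathlib

open FirstOrder Cardinal

universe u v w w'

namespace ModelTypes

open FirstOrder.Language

/-- `L`-formulas in the free variables `α` with parameters from `N`; the left summand of the
index type carries the parameters. -/
abbrev PFormula (L : FirstOrder.Language.{u, v}) (N : Type w) (α : Type w') := L.Formula (N ⊕ α)

namespace PFormula

variable {L : FirstOrder.Language.{u, v}} {N : Type w} {α : Type w'}

/-- The parametrised formula `φ` holds in `N` at the tuple `x`. -/
def Sat [L.Structure N] (φ : PFormula L N α) (x : α → N) : Prop :=
  φ.Realize (Sum.elim id x)

/-- Replace every parameter `c` by `f c`. -/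
def mapParams {K : Type*} (f : N → K) (φ : PFormula L N α) : PFormula L K α :=
  φ.relabel (Sum.map f id)

/-- All parameters of `φ` lie in `A`. -/
def IsOver (A : Set N) (φ : PFormula L N α) : Prop :=
  ∃ φ₀ : PFormula L A α, φ₀.mapParams Subtype.val = φ

/-- `φ` as a sentence in which the parameters and the free variables are constant symbols. -/
def toSentence (φ : PFormula L N α) : L[[N]][[α]].Sentence :=
  Formula.equivSentence (BoundedFormula.constantsVarsEquiv.symm φ)

end PFormula

/-- The formula `x = x` in one free variable. -/
def xEqX (L : FirstOrder.Language.{u, v}) (N : Type w) : PFormula L N Unit :=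
  (Term.var (Sum.inr ())).equal (Term.var (Sum.inr ()))

/-- `S₁(N)`: the complete `1`-types over the structure `N`. -/
abbrev S₁ (L : FirstOrder.Language.{u, v}) (N : Type w) [L.Structure N] :=
  (L.elementaryDiagram N).CompleteType Unit

section Types

variable {L : FirstOrder.Language.{u, v}} {N : Type w} [L.Structure N]

/-- `φ ∈ p`. -/
def Mem (φ : PFormula L N Unit) (p : S₁ L N) : Prop := φ.toSentence ∈ p

/-- The instance `φ(x, b)` of an `L`-formula `φ(y, x)` at a tuple `b` of `N`. -/
def inst {β : Type*} (φ : L.Formula (β ⊕ Unit)) (b : β → N) : PFormula L N Unit :=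
  φ.relabel (Sum.map b id)

/-- `p` is definable over `A`: for each `L`-formula `φ(x, y)` the set of tuples `b` in `N` with
`φ(x, b) ∈ p` is definable in `N` over `A`. -/
def IsDefinableOver (p : S₁ L N) (A : Set N) : Prop :=
  ∀ (n : ℕ) (φ : L.Formula (Fin n ⊕ Unit)), A.Definable L {b : Fin n → N | Mem (inst φ b) p}

/-- `p` is invariant under all automorphisms of `N` that fix `A` pointwise. -/
def IsInvariantOver (p : S₁ L N) (A : Set N) : Prop :=
  ∀ σ : N ≃[L] N, (∀ a ∈ A, σ a = a) →
    ∀ φ : PFormula L N Unit, Mem φ p ↔ Mem (φ.mapParams σ) p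

/-- No formula of `p` has only finitely many solutions. -/
def IsNonalgebraic (p : S₁ L N) : Prop :=
  ∀ φ : PFormula L N Unit, Mem φ p → {a : N | φ.Sat fun _ => a}.Infinite

/-- `a ⊨ p | B`. -/
def Realizes (a : N) (p : S₁ L N) (B : Set N) : Prop :=
  ∀ φ : PFormula L N Unit, φ.IsOver B → Mem φ p → φ.Sat fun _ => a

/-- The restriction `p | B`, as a set of sentences in the constants of `N` and the constant
that stands for the variable. -/
def restrict (p : S₁ L N) (B : Set N) : L[[N]][[Unit]].Theory :=
  {s | ∃ φ : PFormula L N Unit, φ.IsOver B ∧ Mem φ p ∧ φ.toSentence = s}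

/-- `p | B ⊢ p | C`, modulo the elementary diagram of `N`. -/
def RestrictEntails (p : S₁ L N) (B C : Set N) : Prop :=
  ∀ s ∈ restrict p C,
    ((L[[N]].lhomWithConstants Unit).onTheory (L.elementaryDiagram N) ∪ restrict p B) ⊨ᵇ s

/-- The pair `(p(x), φ(x))` is strongly regular; "small" means of cardinality less than `κ`. -/
structure IsStronglyRegular (κ : Cardinal.{w}) (p : S₁ L N) (φ : PFormula L N Unit) : Prop where
  nonalgebraic : IsNonalgebraic p
  mem : Mem φ p
  regular : ∃ A : Set N, #A < κ ∧ φ.IsOver A ∧ IsInvariantOver p A ∧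
    ∀ B : Set N, A ⊆ B → ∀ a : N, (φ.Sat fun _ => a) →
      Realizes a p B ∨ RestrictEntails p B (insert a B)

/-- The solution set of `dom`, with the operation whose graph is defined by `mul`, is a group. -/
def DefinesGroup (dom : PFormula L N Unit) (mul : PFormula L N (Fin 3)) : Prop :=
  ∃ _ : Group {x : N // dom.Sat fun _ => x},
    ∀ a b c : {x : N // dom.Sat fun _ => x}, mul.Sat ![a.1, b.1, c.1] ↔ a * b = c

/-- The definable group `G` given by `dom` and `mul` is a regular group, witnessed by `p`. -/
def IsRegularGroupWitnessedBy (κ : Cardinal.{w}) (dom : PFormula L N Unit)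
    (mul : PFormula L N (Fin 3)) (p : S₁ L N) : Prop :=
  DefinesGroup dom mul ∧ IsStronglyRegular κ p dom

end Types

/-- `q ∈ S₁(N)` is an heir of `p ∈ S₁(M)`, for an elementary embedding `j` of `M` into `N`:
`q` extends `p`, and whenever `φ(x, c) ∈ q` with `φ(x, y)` over `M` and `c` a tuple of `N`, there
is a tuple `b` of `M` with `φ(x, b) ∈ p`. -/
structure IsHeir {L : FirstOrder.Language.{u, v}} {M : Type w} {N : Type w'} [L.Structure M] [L.Structure N]
    (j : M ↪ₑ[L] N) (p : S₁ L M) (q : S₁ L N) : Prop where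
  extends_base : ∀ φ : PFormula L M Unit, Mem φ p → Mem (φ.mapParams j) q
  heir : ∀ (n : ℕ) (φ : L.Formula ((M ⊕ Fin n) ⊕ Unit)) (c : Fin n → N),
    Mem (inst φ (Sum.elim j c)) q → ∃ b : Fin n → M, Mem (inst φ (Sum.elim id b)) p

/-- `N` is `κ`-saturated: every set of formulas in one variable over a set `A` of cardinality
less than `κ` that is finitely satisfiable in `N` is realized in `N`. -/
def IsSaturated (L : FirstOrder.Language.{u, v}) (N : Type w) [L.Structure N] (κ : Cardinal.{w}) : Prop :=
  ∀ A : Set N, #A < κ → ∀ Φ : Set (PFormula L N Unit), (∀ φ ∈ Φ, φ.IsOver A) →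
    (∀ Ψ : Finset (PFormula L N Unit), (Ψ : Set (PFormula L N Unit)) ⊆ Φ →
      ∃ a : N, ∀ φ ∈ Ψ, φ.Sat fun _ => a) →
    ∃ a : N, ∀ φ ∈ Φ, φ.Sat fun _ => a

/-- `M` is quasiminimal: the language is countable, `M` is uncountable, and every subset of `M`
that is definable with parameters is countable or co-countable. -/
structure IsQuasiminimal (L : FirstOrder.Language.{u, v}) (M : Type w) [L.Structure M] : Prop where
  countable_language : Countable L.Symbols
  uncountable : Uncountable M
  countable_or_cocountable : ∀ X : Set M, (Set.univ : Set M).Definable₁ L X →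
    X.Countable ∨ Xᶜ.Countable

section Quasiminimal

variable {L : FirstOrder.Language.{u, v}} {M : Type w} [L.Structure M]

/-- `p` is the generic type of `M`: it consists of the formulas that define a co-countable
subset of `M`. -/
def IsGenericType (p : S₁ L M) : Prop :=
  ∀ φ : PFormula L M Unit, Mem φ p ↔ {a : M | φ.Sat fun _ => a}ᶜ.Countable

/-- `p` is left translation invariant: `φ(x) ∈ p` iff `φ(g * x) ∈ p`. Here `ψ(x)` is any formula
that is equivalent to `φ(g * x)`. -/
def IsLeftInvariant [Group M] (p : S₁ L M) : Prop :=
  ∀ (g : M) (φ ψ : PFormula L M Unit),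
    (∀ x : M, ψ.Sat (fun _ => x) ↔ φ.Sat fun _ => g * x) → (Mem φ p ↔ Mem ψ p)

/-- `p` is right translation invariant: `φ(x) ∈ p` iff `φ(x * g) ∈ p`. -/
def IsRightInvariant [Group M] (p : S₁ L M) : Prop :=
  ∀ (g : M) (φ ψ : PFormula L M Unit),
    (∀ x : M, ψ.Sat (fun _ => x) ↔ φ.Sat fun _ => x * g) → (Mem φ p ↔ Mem ψ p)

end Quasiminimal

end ModelTypes

open ModelTypes

/-! The point is that co-countability of a definable set `X ⊆ M` is a first-order condition: it
holds iff `X · X = M`. If `X` is countable, so is `X · X`. If `X` is co-countable, then for each `z`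
all but countably many `x` have both `x` and `x⁻¹z` in `X`. This is
`IsCancelGraph.productCovers_iff`, and it needs much less than a group.

The criterion defines `p` over the parameters of the multiplication. Any other parameters for which
the same formula is the graph of a cancellative operation give the same answer, so the parameters
can be quantified away and `p` is definable over `∅`.

In the extension, call a definable `X` generic if `X · X` is everything. That generic sets form an
ultrafilter on definable sets is, formula by formula, a first-order statement true in `M`, so it
transfers by `realize_of_forall_realize`. The resulting type `q` is the only heir, since an heir of
a definable type must obey the same definition.

Regularity is the transferred form of "a countable union of countable sets is countable"
(`IsQuasiminimal.not_productCovers_exception`). If `a` fails `q|B`, it lies in a non-generic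
`B`-definable set `Y`. For `ψ(a, x) ∈ q`, the points missed by some generic `ψ(y, x)` with `y ∈ Y`
form a non-generic `B`-definable set. Its complement is in `q|B` and implies `ψ(a, x)`. -/

namespace ModelTypes

open FirstOrder.Language

/-! ### Transfer of formulas to elementary extensions. -/

section Formulas

variable {L : FirstOrder.Language.{u, v}}

/-- A formula depends on finitely many of its parameters only. -/
lemma exists_finite_params {γ α : Type*} (φ : L.Formula (γ ⊕ α))
    (K K' : Type*) [L.Structure K] [L.Structure K'] :
    ∃ (n : ℕ) (c : Fin n → γ) (φ₀ : L.Formula (Fin n ⊕ α)), Function.Injective c ∧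
      (∀ v : γ ⊕ α → K, φ.Realize v ↔ φ₀.Realize (v ∘ Sum.map c id)) ∧
      ∀ v : γ ⊕ α → K', φ.Realize v ↔ φ₀.Realize (v ∘ Sum.map c id) := by
  classical
  let s : Finset γ := φ.freeVarFinset.toLeft
  let f : φ.freeVarFinset → Fin s.card ⊕ α := fun x =>
    match x with
    | ⟨Sum.inl g, h⟩ => Sum.inl (s.equivFin ⟨g, by simpa [s] using h⟩)
    | ⟨Sum.inr a, _⟩ => Sum.inr a
  have hf : ∀ (x : φ.freeVarFinset), Sum.map (fun i => (s.equivFin.symm i : γ)) id (f x) = x := by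
    rintro ⟨g | a, h⟩ <;> simp [f]
  refine ⟨s.card, fun i => s.equivFin.symm i, φ.restrictFreeVar f,
    Subtype.val_injective.comp s.equivFin.symm.injective, fun v => ?_, fun v => ?_⟩ <;>
  exact (BoundedFormula.realize_restrictFreeVar _ fun x => by simp [hf]).symm

/-- A first-order property with parameters in `M` passes from all tuples of `M` to all tuples of an
elementary extension. -/
lemma realize_of_forall_realize {M N γ : Type*} [L.Structure M] [L.Structure N] [Nonempty M]
    (j : M ↪ₑ[L] N) (φ : L.Formula (M ⊕ γ)) (h : ∀ v : γ → M, φ.Realize (Sum.elim id v))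
    (w : γ → N) : φ.Realize (Sum.elim j w) := by
  -- The swap makes the variables in `γ`, of which there may be infinitely many, play the role of
  -- parameters. Only finitely many occur, so they can be bound by a universal quantifier, while the
  -- elements of `M` stay free and are moved by `j`.
  obtain ⟨n, c, φ₀, hc, h₁, h₂⟩ := exists_finite_params (φ.relabel Sum.swap) M N
  have key : (Formula.iAlls (Fin n) (φ₀.relabel Sum.swap)).Realize (id : M → M) := by
    rw [Formula.realize_iAlls]
    intro v
    have := (h₁ (Sum.elim (Function.extend c v fun _ => Classical.arbitrary M) id)).1 (by
      rw [Formula.realize_relabel]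
      convert h (Function.extend c v fun _ => Classical.arbitrary M) using 1
      ext (x | x) <;> rfl)
    rw [Formula.realize_relabel]
    convert this using 1
    ext (x | x)
    · simp [hc.extend_apply]
    · rfl
  rw [← j.map_formula, Formula.realize_iAlls] at key
  have := (h₂ (Sum.elim w j)).2 (by
    have := key (w ∘ c)
    rw [Formula.realize_relabel] at this
    convert this using 1
    ext (x | x) <;> rfl)
  rw [Formula.realize_relabel] at this
  convert this using 1
  ext (x | x) <;> rfl

/-! ### Genericity as covering by products. -/

/-- `X · X` is everything, for a ternary relation `R`, read as `x · y = z`. -/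
def ProductCovers {K : Type*} (R : K → K → K → Prop) (X : Set K) : Prop :=
  ∀ z, ∃ x ∈ X, ∃ y ∈ X, R x y z

/-- `R` is the graph of a partial operation for which the equation `x * y = z` has, for given `x`
and `z`, a solution `y`, and, for given `y` and `z`, at most one solution `x`. -/
structure IsCancelGraph {K : Type*} (R : K → K → K → Prop) : Prop where
  functional : ∀ x y z z', R x y z → R x y z' → z = z'
  solvable : ∀ x z, ∃ y, R x y z
  cancel : ∀ x x' y z, R x y z → R x' y z → x = x'

/-- Functionality makes `z` a function of the pair `(x, y)`, so a countable `X` covers only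
countably many `z`. Conversely, solving for `y` gives a map `x ↦ y` that is injective by
cancellation, so it pulls the countable complement back to a countable set. -/
lemma IsCancelGraph.productCovers_iff {K : Type*} [Uncountable K] {R : K → K → K → Prop}
    (hR : IsCancelGraph R) {X : Set K} (hX : X.Countable ∨ Xᶜ.Countable) :
    ProductCovers R X ↔ Xᶜ.Countable := by
  constructor
  · intro h
    refine hX.resolve_left fun hc => ?_
    choose f hf g hg hfg using h
    have := hc.to_subtype
    have hinj : Function.Injective fun z => ((⟨f z, hf z⟩, ⟨g z, hg z⟩) : X × X) := by
      intro z z' hz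
      simp only [Prod.mk.injEq, Subtype.mk.injEq] at hz
      exact hR.functional _ _ _ _ (hfg z) (by rw [hz.1, hz.2]; exact hfg z')
    exact not_countable (α := K) hinj.countable
  · intro h z
    choose g hg using fun x => hR.solvable x z
    have hinj : Function.Injective g := fun x x' hx =>
      hR.cancel _ _ _ _ (hg x) (hx ▸ hg x')
    -- A point outside both countable sets is an `x ∈ X` whose partner `g x` is in `X` too.
    have hne : Xᶜ ∪ g ⁻¹' Xᶜ ≠ Set.univ := fun hu => by
      have := h.union (h.preimage hinj)
      rw [hu, Set.countable_univ_iff] at this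
      exact not_countable this
    obtain ⟨x, hx⟩ := (Set.ne_univ_iff_exists_notMem _).1 hne
    simp only [Set.mem_union, Set.mem_compl_iff, Set.mem_preimage, not_or, not_not] at hx
    exact ⟨x, hx.1, g x, hx.2, hg x⟩

lemma IsCancelGraph.of_group {G : Type*} [Group G] :
    IsCancelGraph fun a b c : G => a * b = c where
  functional _ _ _ _ h h' := h.symm.trans h'
  solvable x z := ⟨x⁻¹ * z, by simp⟩
  cancel _ _ _ _ h h' := mul_right_cancel (h.trans h'.symm)

lemma ProductCovers.mono {K : Type*} {R : K → K → K → Prop} {X Y : Set K}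
    (h : ProductCovers R X) (hXY : X ⊆ Y) : ProductCovers R Y := fun z =>
  let ⟨x, hx, y, hy, hz⟩ := h z
  ⟨x, hXY hx, y, hXY hy, hz⟩

lemma IsCancelGraph.infinite_of_productCovers {K : Type*} [Infinite K] {R : K → K → K → Prop}
    (hR : IsCancelGraph R) {X : Set K} (h : ProductCovers R X) : X.Infinite := by
  intro hfin
  choose f hf g hg hfg using h
  have := hfin.to_subtype
  have hinj : Function.Injective fun z => ((⟨f z, hf z⟩, ⟨g z, hg z⟩) : X × X) := by
    intro z z' hz
    simp only [Prod.mk.injEq, Subtype.mk.injEq] at hz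
    exact hR.functional _ _ _ _ (hfg z) (by rw [hz.1, hz.2]; exact hfg z')
  exact not_finite_iff_infinite.2 ‹Infinite K› (Finite.of_injective _ hinj)

/-! ### First-order formulas for covering, cancellation and exceptional points. -/

variable {γ δ K : Type*} [L.Structure K]

/-- The subset of `K` that is defined by `φ` at the parameters `v`. -/
def solutionSet (φ : L.Formula (γ ⊕ Unit)) (v : γ → K) : Set K :=
  {x | φ.Realize (Sum.elim v fun _ => x)}

/-- The ternary relation on `K` that is defined by `μ` at the parameters `v`. -/
def ternaryRel (μ : L.Formula (γ ⊕ Fin 3)) (v : γ → K) (x y z : K) : Prop :=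
  μ.Realize (Sum.elim v ![x, y, z])

/-- Substitute variables for the variable of `φ` and for its parameters. -/
def subst₁ (φ : L.Formula (γ ⊕ Unit)) (f : γ → δ) (x : δ) : L.Formula δ :=
  φ.relabel (Sum.elim f fun _ => x)

/-- Substitute variables for the three variables of `μ` and for its parameters. -/
def subst₃ (μ : L.Formula (γ ⊕ Fin 3)) (f : γ → δ) (x y z : δ) : L.Formula δ :=
  μ.relabel (Sum.elim f ![x, y, z])

@[simp] lemma realize_subst₁ (φ : L.Formula (γ ⊕ Unit)) (f : γ → δ) (x : δ) (v : δ → K) :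
    (subst₁ φ f x).Realize v ↔ v x ∈ solutionSet φ (v ∘ f) := by
  rw [subst₁, Formula.realize_relabel, solutionSet, Set.mem_ofPred_eq]
  exact iff_of_eq (congrArg _ (by ext (i | i) <;> rfl))

@[simp] lemma realize_subst₃ (μ : L.Formula (γ ⊕ Fin 3)) (f : γ → δ) (x y z : δ) (v : δ → K) :
    (subst₃ μ f x y z).Realize v ↔ ternaryRel μ (v ∘ f) (v x) (v y) (v z) := by
  rw [subst₃, Formula.realize_relabel, ternaryRel]
  refine iff_of_eq (congrArg _ ?_)
  ext (i | i)
  · rfl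
  · fin_cases i <;> rfl

@[simp] lemma solutionSet_not (φ : L.Formula (γ ⊕ Unit)) (v : γ → K) :
    solutionSet φ.not v = (solutionSet φ v)ᶜ :=
  Set.ext fun _ => Formula.realize_not

@[simp] lemma solutionSet_inf (φ ψ : L.Formula (γ ⊕ Unit)) (v : γ → K) :
    solutionSet (φ ⊓ ψ) v = solutionSet φ v ∩ solutionSet ψ v :=
  Set.ext fun _ => Formula.realize_inf

lemma solutionSet_relabel (φ : L.Formula (γ ⊕ Unit)) (f : γ → δ) (v : δ → K) :
    solutionSet (φ.relabel (Sum.map f id)) v = solutionSet φ (v ∘ f) := by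
  ext x
  simp only [solutionSet, Set.mem_ofPred_eq, Formula.realize_relabel]
  exact iff_of_eq (congrArg _ (by ext (i | i) <;> rfl))

lemma ternaryRel_relabel (μ : L.Formula (γ ⊕ Fin 3)) (f : γ → δ) (v : δ → K) :
    ternaryRel (μ.relabel (Sum.map f id)) v = ternaryRel μ (v ∘ f) := by
  ext x y z
  simp only [ternaryRel, Formula.realize_relabel]
  exact iff_of_eq (congrArg _ (by ext (i | i) <;> rfl))

/-- The formula that expresses `ProductCovers`. -/
noncomputable def coversFormula (μ : L.Formula (γ ⊕ Fin 3)) (φ : L.Formula (γ ⊕ Unit)) :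
    L.Formula γ :=
  Formula.iAlls Unit <| Formula.iExs (Fin 2) <|
    subst₁ φ (Sum.inl ∘ Sum.inl) (Sum.inr 0) ⊓ (subst₁ φ (Sum.inl ∘ Sum.inl) (Sum.inr 1) ⊓
      subst₃ μ (Sum.inl ∘ Sum.inl) (Sum.inr 0) (Sum.inr 1) (Sum.inl (Sum.inr ())))

@[simp] lemma realize_coversFormula (μ : L.Formula (γ ⊕ Fin 3)) (φ : L.Formula (γ ⊕ Unit))
    (v : γ → K) :
    (coversFormula μ φ).Realize v ↔ ProductCovers (ternaryRel μ v) (solutionSet φ v) := by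
  simp only [coversFormula, Formula.realize_iAlls, Formula.realize_iExs, Formula.realize_inf,
    realize_subst₁, realize_subst₃, ProductCovers]
  constructor
  · intro h z
    obtain ⟨i, h₁, h₂, h₃⟩ := h fun _ => z
    exact ⟨i 0, h₁, i 1, h₂, h₃⟩
  · intro h z
    obtain ⟨x, hx, y, hy, hz⟩ := h (z ())
    exact ⟨![x, y], hx, hy, hz⟩

/-- The formula that expresses `IsCancelGraph`. -/
noncomputable def cancelFormula (μ : L.Formula (γ ⊕ Fin 3)) : L.Formula γ :=
  Formula.iAlls (Fin 4)
      ((subst₃ μ Sum.inl (Sum.inr 0) (Sum.inr 1) (Sum.inr 2)).imp <|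
        (subst₃ μ Sum.inl (Sum.inr 0) (Sum.inr 1) (Sum.inr 3)).imp <|
          (Term.var (Sum.inr 2)).equal (Term.var (Sum.inr 3))) ⊓
    (Formula.iAlls (Fin 2) (Formula.iExs Unit
      (subst₃ μ (Sum.inl ∘ Sum.inl) (Sum.inl (Sum.inr 0)) (Sum.inr ()) (Sum.inl (Sum.inr 1)))) ⊓
    Formula.iAlls (Fin 4)
      ((subst₃ μ Sum.inl (Sum.inr 0) (Sum.inr 2) (Sum.inr 3)).imp <|
        (subst₃ μ Sum.inl (Sum.inr 1) (Sum.inr 2) (Sum.inr 3)).imp <|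
          (Term.var (Sum.inr 0)).equal (Term.var (Sum.inr 1))))

@[simp] lemma realize_cancelFormula (μ : L.Formula (γ ⊕ Fin 3)) (v : γ → K) :
    (cancelFormula μ).Realize v ↔ IsCancelGraph (ternaryRel μ v) := by
  simp only [cancelFormula, Formula.realize_iAlls, Formula.realize_iExs, Formula.realize_inf,
    realize_subst₃, Formula.realize_imp, Formula.realize_equal, Term.realize_var]
  constructor
  · rintro ⟨h₁, h₂, h₃⟩
    refine ⟨fun x y z z' => h₁ ![x, y, z, z'], fun x z => ?_, fun x x' y z => h₃ ![x, x', y, z]⟩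
    obtain ⟨y, hy⟩ := h₂ ![x, z]
    exact ⟨y (), hy⟩
  · intro h
    refine ⟨fun i => h.functional _ _ _ _, fun i => ?_, fun i => h.cancel _ _ _ _⟩
    obtain ⟨y, hy⟩ := h.solvable (i 0) (i 1)
    exact ⟨fun _ => y, hy⟩

/-- The formula in `x` that says that, for some solution `y` of `φ`, the solutions of `ψ(y, x)` have
everything as product set and do not include `x`. -/
noncomputable def exceptionFormula (μ : L.Formula (γ ⊕ Fin 3)) (φ : L.Formula (γ ⊕ Unit))
    (ψ : L.Formula ((γ ⊕ Unit) ⊕ Unit)) : L.Formula (γ ⊕ Unit) :=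
  Formula.iExs Unit <|
    subst₁ φ (Sum.inl ∘ Sum.inl) (Sum.inr ()) ⊓
      ((coversFormula (μ.relabel (Sum.map Sum.inl id)) ψ).relabel
          (Sum.elim (Sum.inl ∘ Sum.inl) fun _ => Sum.inr ()) ⊓
        (subst₁ ψ (Sum.elim (Sum.inl ∘ Sum.inl) fun _ => Sum.inr ())
          (Sum.inl (Sum.inr ()))).not)

lemma solutionSet_exceptionFormula (μ : L.Formula (γ ⊕ Fin 3)) (φ : L.Formula (γ ⊕ Unit))
    (ψ : L.Formula ((γ ⊕ Unit) ⊕ Unit)) (v : γ → K) :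
    solutionSet (exceptionFormula μ φ ψ) v =
      {x | ∃ y ∈ solutionSet φ v,
        ProductCovers (ternaryRel μ v) (solutionSet ψ (Sum.elim v fun _ => y)) ∧
          x ∉ solutionSet ψ (Sum.elim v fun _ => y)} := by
  have e : ∀ (x : K) (i : Unit → K),
      Sum.elim (Sum.elim v fun _ : Unit => x) i ∘ Sum.elim (Sum.inl ∘ Sum.inl) (fun _ => Sum.inr ())
        = (Sum.elim v fun _ : Unit => i () : γ ⊕ Unit → K) := fun x i => by
    ext (k | k) <;> rfl
  ext x
  simp only [solutionSet, exceptionFormula, Set.mem_ofPred_eq, Formula.realize_iExs,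
    Formula.realize_inf, Formula.realize_not, realize_subst₁, Formula.realize_relabel,
    realize_coversFormula, e, ternaryRel_relabel]
  constructor
  · rintro ⟨i, h₁, h₂, h₃⟩
    exact ⟨i (), h₁, h₂, h₃⟩
  · rintro ⟨y, h₁, h₂, h₃⟩
    exact ⟨fun _ => y, h₁, h₂, h₃⟩

end Formulas

/-! ### Complete types as ultrafilters of definable sets. -/

section CompleteTypes

variable {L : FirstOrder.Language.{u, v}} {N : Type w}

lemma toSentence_imp (φ ψ : PFormula L N Unit) :
    PFormula.toSentence (φ.imp ψ) = φ.toSentence.imp ψ.toSentence := rfl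

lemma toSentence_not (φ : PFormula L N Unit) :
    PFormula.toSentence φ.not = φ.toSentence.not := rfl

lemma exists_toSentence_eq (s : L[[N]][[Unit]].Sentence) :
    ∃ φ : PFormula L N Unit, φ.toSentence = s :=
  ⟨BoundedFormula.constantsVarsEquiv (Formula.equivSentence.symm s), by simp [PFormula.toSentence]⟩

variable [L.Structure N]

lemma realize_constantsVarsEquiv_symm (φ : PFormula L N Unit) (a : N) :
    Formula.Realize (L := L[[N]]) (BoundedFormula.constantsVarsEquiv.symm φ) (fun _ => a) ↔
      φ.Sat fun _ => a := by
  rw [PFormula.Sat, Formula.Realize, Formula.Realize, ← BoundedFormula.realize_constantsVarsEquiv,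
    Equiv.apply_symm_apply]
  exact Iff.rfl

/-- A formula that holds everywhere follows from the elementary diagram. -/
lemma models_toSentence (φ : PFormula L N Unit) (h : ∀ a : N, φ.Sat fun _ => a) :
    (L[[N]].lhomWithConstants Unit).onTheory (L.elementaryDiagram N) ⊨ᵇ φ.toSentence := by
  rw [PFormula.toSentence, ← Theory.models_formula_iff_onTheory_models_equivSentence,
    Theory.models_formula_iff]
  intro K v
  let θ : L[[N]].Formula Unit := BoundedFormula.constantsVarsEquiv.symm φ
  let s : L[[N]].Sentence := Formula.iAlls Unit (θ.relabel Sum.inr)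
  have hs : s ∈ L.elementaryDiagram N := by
    refine (mem_completeTheory (L := L[[N]])).2 ?_
    rw [Sentence.Realize, Formula.realize_iAlls]
    intro i
    rw [Formula.realize_relabel]
    exact (realize_constantsVarsEquiv_symm φ (i ())).2 (h _)
  have := (Theory.model_iff _).1 K.is_model s hs
  rw [Sentence.Realize, Formula.realize_iAlls] at this
  have := this v
  rwa [Formula.realize_relabel] at this

lemma Mem.mono {p : S₁ L N} {φ ψ : PFormula L N Unit} (hφ : Mem φ p)
    (h : ∀ a : N, (φ.Sat fun _ => a) → ψ.Sat fun _ => a) : Mem ψ p := by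
  have himp := p.mem_of_models (models_toSentence (φ.imp ψ) fun a => Formula.realize_imp.2 (h a))
  rw [toSentence_imp] at himp
  refine p.isMaximal.mem_of_models ?_
  rw [Theory.models_sentence_iff]
  intro K
  have h₁ := (Theory.model_iff _).1 K.is_model _ hφ
  have h₂ := (Theory.model_iff _).1 K.is_model _ himp
  exact BoundedFormula.realize_imp.1 h₂ h₁

lemma mem_not_iff {p : S₁ L N} {φ : PFormula L N Unit} : Mem φ.not p ↔ ¬ Mem φ p := by
  rw [Mem, toSentence_not]
  exact p.not_mem_iff _

lemma type_ext {p q : S₁ L N} (h : ∀ φ : PFormula L N Unit, Mem φ p → Mem φ q) : p = q := by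
  refine SetLike.ext fun s => ?_
  obtain ⟨φ, rfl⟩ := exists_toSentence_eq s
  refine ⟨h φ, fun hq => by_contra fun hp => ?_⟩
  exact mem_not_iff.1 (h _ (mem_not_iff.2 hp)) hq

lemma mem_typeOf_iff [Nonempty N] (φ : PFormula L N Unit) (a : N) :
    Mem φ ((L.elementaryDiagram N).typeOf fun _ => a) ↔ φ.Sat fun _ => a := by
  rw [Mem, Theory.CompleteType.mem_typeOf, PFormula.toSentence, Equiv.symm_apply_apply]
  exact realize_constantsVarsEquiv_symm φ a

/-- A family of nonempty definable sets that is closed under intersection and that has, of each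
definable set and its complement, at least one, is a complete type. -/
lemma exists_type_mem_iff (P : Set N → Prop)
    (nonempty : ∀ X, P X → X.Nonempty)
    (inter : ∀ φ ψ : PFormula L N Unit, P (solutionSet φ id) → P (solutionSet ψ id) →
      P (solutionSet φ id ∩ solutionSet ψ id))
    (compl : ∀ φ : PFormula L N Unit, P (solutionSet φ id) ∨ P (solutionSet φ id)ᶜ) :
    ∃ p : S₁ L N, ∀ φ : PFormula L N Unit, Mem φ p ↔ P (solutionSet φ id) := by
  classical
  let T : L[[N]][[Unit]].Theory :=
    {s | ∃ φ : PFormula L N Unit, P (solutionSet φ id) ∧ φ.toSentence = s}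
  have hN : Nonempty N := by
    rcases compl ⊥ with h | h <;> exact (nonempty _ h).to_type
  -- Finitely many sentences are absorbed into a single formula `χ` of the family; any solution of
  -- `χ` then has a type containing them all, which gives finite satisfiability.
  have hfin : ∀ F : Finset L[[N]][[Unit]].Sentence,
      (F : Set L[[N]][[Unit]].Sentence) ⊆
        (L[[N]].lhomWithConstants Unit).onTheory (L.elementaryDiagram N) ∪ T →
      ∃ χ : PFormula L N Unit, P (solutionSet χ id) ∧
        ∀ a ∈ solutionSet χ id, ∀ s ∈ F, s ∈ (L.elementaryDiagram N).typeOf fun _ : Unit => a := by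
    intro F
    induction F using Finset.induction_on with
    | empty =>
      intro _
      refine ⟨⊤, ?_, by simp⟩
      refine (compl ⊤).resolve_right fun h => ?_
      obtain ⟨a, ha⟩ := nonempty _ h
      exact ha (by simp [solutionSet])
    | insert s F _ ih =>
      intro hF
      rw [Finset.coe_insert, Set.insert_subset_iff] at hF
      obtain ⟨χ, hχ, hχF⟩ := ih hF.2
      rcases hF.1 with hs | ⟨φ, hφ, rfl⟩
      · refine ⟨χ, hχ, fun a ha t ht => ?_⟩
        rcases Finset.mem_insert.1 ht with rfl | ht
        · exact ((L.elementaryDiagram N).typeOf fun _ : Unit => a).subset hs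
        · exact hχF a ha t ht
      · have hinf : solutionSet (φ ⊓ χ) (id : N → N) = solutionSet φ id ∩ solutionSet χ id := by
          ext a
          exact Formula.realize_inf
        refine ⟨φ ⊓ χ, hinf ▸ inter _ _ hφ hχ, fun a ha t ht => ?_⟩
        rw [hinf] at ha
        rcases Finset.mem_insert.1 ht with rfl | ht
        · exact (mem_typeOf_iff φ a).2 ha.1
        · exact hχF a ha.2 t ht
  have hsat : ((L[[N]].lhomWithConstants Unit).onTheory (L.elementaryDiagram N) ∪
      T).IsSatisfiable := by
    rw [Theory.isSatisfiable_iff_isFinitelySatisfiable]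
    intro F hF
    obtain ⟨χ, hχ, hχF⟩ := hfin F hF
    obtain ⟨a, ha⟩ := nonempty _ hχ
    exact ((L.elementaryDiagram N).typeOf fun _ : Unit => a).isMaximal.1.mono
      fun s hs => hχF a ha s hs
  obtain ⟨p, hp⟩ : {p : S₁ L N | T ⊆ ↑p}.Nonempty := by
    rw [Set.nonempty_iff_ne_empty, Ne, Theory.CompleteType.setOfPred_subset_eq_empty_iff, not_not]
    exact hsat
  have hmem : ∀ φ : PFormula L N Unit, P (solutionSet φ id) → Mem φ p := fun φ hφ => hp ⟨φ, hφ, rfl⟩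
  refine ⟨p, fun φ => ⟨fun h => (compl φ).resolve_right fun hc => ?_, hmem φ⟩⟩
  refine mem_not_iff.1 (hmem φ.not ?_) h
  rwa [solutionSet_not]

/-- Reduces entailment to inclusion of definable sets in `N`, since the elementary diagram decides
every inclusion. -/
lemma restrictEntails_of_forall {q : S₁ L N} {B C : Set N}
    (h : ∀ ψ : PFormula L N Unit, ψ.IsOver C → Mem ψ q → ∃ χ : PFormula L N Unit,
      χ.IsOver B ∧ Mem χ q ∧ solutionSet χ id ⊆ solutionSet ψ id) : RestrictEntails q B C := by
  rintro _ ⟨ψ, hC, hψ, rfl⟩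
  obtain ⟨χ, hB, hχ, hsub⟩ := h ψ hC hψ
  have himp := models_toSentence (χ.imp ψ) fun a => Formula.realize_imp.2 (@hsub a)
  rw [Theory.models_sentence_iff] at himp ⊢
  intro K
  have hK := (Theory.model_iff _).1 K.is_model
  have h₁ := hK _ (Or.inr ⟨χ, hB, hχ, rfl⟩)
  have h₂ : K ⊨ PFormula.toSentence (χ.imp ψ) := by
    have : K ⊨ (L[[N]].lhomWithConstants Unit).onTheory (L.elementaryDiagram N) :=
      (Theory.model_iff _).2 fun s hs => hK s (Or.inl hs)
    exact himp (Theory.ModelType.of _ K)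
  rw [toSentence_imp] at h₂
  exact BoundedFormula.realize_imp.1 h₂ h₁

end CompleteTypes

lemma exists_group_of_graph {G : Type*} (R : G → G → G → Prop) (e : G)
    (total : ∀ a b, ∃ c, R a b c) (functional : ∀ a b c c', R a b c → R a b c' → c = c')
    (assoc : ∀ a b c x y s t, R a b x → R x c s → R b c y → R a y t → s = t)
    (one : ∀ a, R e a a) (inv : ∀ a, ∃ b, R b a e) :
    ∃ _ : Group G, ∀ a b c : G, R a b c ↔ a * b = c := by
  choose m hm using total
  choose i hi using inv
  have hR : ∀ a b c, R a b c ↔ m a b = c := fun a b c =>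
    ⟨fun h => functional _ _ _ _ (hm a b) h, fun h => h ▸ hm a b⟩
  let _ : Mul G := ⟨m⟩
  let _ : One G := ⟨e⟩
  let _ : Inv G := ⟨i⟩
  exact ⟨Group.ofLeftAxioms
    (fun a b c => assoc a b c _ _ _ _ (hm a b) (hm _ c) (hm b c) (hm a _))
    (fun a => (hR _ _ _).1 (one a)) (fun a => (hR _ _ _).1 (hi a)), hR⟩

/-! ### Generic sets in the extension, and the group structure there. -/

section Quasiminimal

variable {L : FirstOrder.Language.{u, v}} {M : Type w} [L.Structure M] {γ : Type*}

lemma solutionSet_inst {N β : Type*} [L.Structure N] (φ : L.Formula (β ⊕ Unit)) (b : β → N) :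
    solutionSet (inst φ b) id = solutionSet φ b :=
  solutionSet_relabel φ b id

lemma IsQuasiminimal.solutionSet_countable_or (hM : IsQuasiminimal L M)
    (φ : L.Formula (γ ⊕ Unit)) (v : γ → M) :
    (solutionSet φ v).Countable ∨ (solutionSet φ v)ᶜ.Countable := by
  refine hM.countable_or_cocountable _ ?_
  rw [Set.Definable₁, Set.definable_iff_exists_formula_sum]
  refine ⟨φ.relabel (Sum.map (fun i => ⟨v i, trivial⟩) fun _ => 0), ?_⟩
  ext x
  simp only [Set.mem_ofPred_eq, Formula.realize_relabel, solutionSet]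
  exact iff_of_eq (congrArg _ (by ext (i | i) <;> rfl))

lemma IsQuasiminimal.productCovers_iff (hM : IsQuasiminimal L M)
    {R : M → M → M → Prop} (hR : IsCancelGraph R) (φ : L.Formula (γ ⊕ Unit)) (v : γ → M) :
    ProductCovers R (solutionSet φ v) ↔ (solutionSet φ v)ᶜ.Countable :=
  have := hM.uncountable
  hR.productCovers_iff (hM.solutionSet_countable_or φ v)

variable {N : Type w'} [L.Structure N]

lemma IsCancelGraph.map (j : M ↪ₑ[L] N) {μ : PFormula L M (Fin 3)}
    (hR : IsCancelGraph (ternaryRel μ (id : M → M))) : IsCancelGraph (ternaryRel μ j) := by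
  rw [← realize_cancelFormula] at hR ⊢
  exact (j.map_formula (cancelFormula μ) id).2 hR

/-- In `M` this says that a union of two countable sets is countable. The parameters `w` are
universally quantified there, which is what allows arbitrary parameters in `N`. -/
lemma IsQuasiminimal.productCovers_inter (hM : IsQuasiminimal L M) (j : M ↪ₑ[L] N)
    {μ : PFormula L M (Fin 3)} (hR : IsCancelGraph (ternaryRel μ (id : M → M)))
    {φ ψ : L.Formula (γ ⊕ Unit)} {w : γ → N}
    (hφ : ProductCovers (ternaryRel μ j) (solutionSet φ w))
    (hψ : ProductCovers (ternaryRel μ j) (solutionSet ψ w)) :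
    ProductCovers (ternaryRel μ j) (solutionSet φ w ∩ solutionSet ψ w) := by
  have := hM.uncountable
  let μ' : L.Formula ((M ⊕ γ) ⊕ Fin 3) := μ.relabel (Sum.map Sum.inl id)
  let φ' : L.Formula ((M ⊕ γ) ⊕ Unit) := φ.relabel (Sum.map Sum.inr id)
  let ψ' : L.Formula ((M ⊕ γ) ⊕ Unit) := ψ.relabel (Sum.map Sum.inr id)
  have key := realize_of_forall_realize j
    ((coversFormula μ' φ').imp ((coversFormula μ' ψ').imp (coversFormula μ' (φ' ⊓ ψ')))) (by
      intro v
      simp only [Formula.realize_imp, realize_coversFormula, μ', ternaryRel_relabel,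
        Sum.elim_comp_inl, hM.productCovers_iff hR]
      rw [solutionSet_inf, Set.compl_inter]
      exact fun h h' => h.union h') w
  simp only [Formula.realize_imp, realize_coversFormula, μ', ternaryRel_relabel, solutionSet_inf,
    Sum.elim_comp_inl, φ', ψ', solutionSet_relabel, Sum.elim_comp_inr] at key
  exact key hφ hψ

lemma IsQuasiminimal.productCovers_or_compl (hM : IsQuasiminimal L M) (j : M ↪ₑ[L] N)
    {μ : PFormula L M (Fin 3)} (hR : IsCancelGraph (ternaryRel μ (id : M → M)))
    (φ : L.Formula (γ ⊕ Unit)) (w : γ → N) :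
    ProductCovers (ternaryRel μ j) (solutionSet φ w) ∨
      ProductCovers (ternaryRel μ j) (solutionSet φ w)ᶜ := by
  have := hM.uncountable
  let μ' : L.Formula ((M ⊕ γ) ⊕ Fin 3) := μ.relabel (Sum.map Sum.inl id)
  let φ' : L.Formula ((M ⊕ γ) ⊕ Unit) := φ.relabel (Sum.map Sum.inr id)
  have key := realize_of_forall_realize j
    (coversFormula μ' φ' ⊔ coversFormula μ' φ'.not) (by
      intro v
      simp only [Formula.realize_sup, realize_coversFormula, μ', ternaryRel_relabel,
        Sum.elim_comp_inl, hM.productCovers_iff hR]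
      rw [solutionSet_not, compl_compl]
      exact (hM.solutionSet_countable_or _ _).symm) w
  simpa only [Formula.realize_sup, realize_coversFormula, μ', ternaryRel_relabel, solutionSet_not,
    Sum.elim_comp_inl, φ', solutionSet_relabel, Sum.elim_comp_inr] using key

/-- A union of exceptional sets, indexed by a set that is not generic, is not generic. -/
lemma IsQuasiminimal.not_productCovers_exception (hM : IsQuasiminimal L M) (j : M ↪ₑ[L] N)
    {μ : PFormula L M (Fin 3)} (hR : IsCancelGraph (ternaryRel μ (id : M → M)))
    {φ : L.Formula (γ ⊕ Unit)} (ψ : L.Formula ((γ ⊕ Unit) ⊕ Unit)) {w : γ → N}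
    (hφ : ¬ ProductCovers (ternaryRel μ j) (solutionSet φ w)) :
    ¬ ProductCovers (ternaryRel μ j) {x | ∃ y ∈ solutionSet φ w,
        ProductCovers (ternaryRel μ j) (solutionSet ψ (Sum.elim w fun _ => y)) ∧
          x ∉ solutionSet ψ (Sum.elim w fun _ => y)} := by
  have hunc := hM.uncountable
  let μ' : L.Formula ((M ⊕ γ) ⊕ Fin 3) := μ.relabel (Sum.map Sum.inl id)
  let φ' : L.Formula ((M ⊕ γ) ⊕ Unit) := φ.relabel (Sum.map Sum.inr id)
  let ψ' : L.Formula (((M ⊕ γ) ⊕ Unit) ⊕ Unit) := ψ.relabel (Sum.map (Sum.map Sum.inr id) id)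
  have key := realize_of_forall_realize j
    ((coversFormula μ' φ').not.imp (coversFormula μ' (exceptionFormula μ' φ' ψ')).not) (by
      intro v
      simp only [Formula.realize_imp, Formula.realize_not, realize_coversFormula, μ',
        ternaryRel_relabel, Sum.elim_comp_inl, hM.productCovers_iff hR]
      intro hφ hex
      have hc := (hM.solutionSet_countable_or φ' (Sum.elim id v)).resolve_right hφ
      have hex' : (solutionSet (exceptionFormula μ' φ' ψ') (Sum.elim id v)).Countable := by
        rw [solutionSet_exceptionFormula]
        refine (hc.biUnion (t := fun y _ => {x | ProductCovers (ternaryRel μ' (Sum.elim id v))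
          (solutionSet ψ' (Sum.elim (Sum.elim id v) fun _ => y)) ∧
            x ∉ solutionSet ψ' (Sum.elim (Sum.elim id v) fun _ => y)}) fun y _ => ?_).mono ?_
        · simp only [μ', ternaryRel_relabel, Sum.elim_comp_inl, hM.productCovers_iff hR]
          -- If the fibre at `y` is generic, its exceptional points lie in a countable complement;
          -- otherwise the first conjunct fails and there are none.
          by_cases h : (solutionSet ψ' (Sum.elim (Sum.elim id v) fun _ => y))ᶜ.Countable
          · exact h.mono fun x hx => hx.2
          · simp [h]
        · rintro x ⟨y, hy, hx⟩
          exact Set.mem_biUnion hy hx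
      have := hex'.union hex
      rw [Set.union_compl_self, Set.countable_univ_iff] at this
      exact not_countable this) w
  have e : ∀ y : N, (Sum.elim (Sum.elim j w) fun _ : Unit => y) ∘ Sum.map Sum.inr id
      = (Sum.elim w fun _ => y : γ ⊕ Unit → N) := fun y => by
    ext (k | k) <;> rfl
  simp only [Formula.realize_imp, Formula.realize_not, realize_coversFormula, μ',
    ternaryRel_relabel, Sum.elim_comp_inl, solutionSet_exceptionFormula, φ', ψ',
    solutionSet_relabel, Sum.elim_comp_inr, e] at key
  exact key hφ

lemma isCancelGraph_of_sat_iff [Group M] {μ : PFormula L M (Fin 3)}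
    (hmul : ∀ a b c : M, μ.Sat ![a, b, c] ↔ a * b = c) :
    IsCancelGraph (ternaryRel μ (id : M → M)) := by
  have : ternaryRel μ (id : M → M) = fun a b c => a * b = c := by
    ext a b c
    exact hmul a b c
  rw [this]
  exact IsCancelGraph.of_group

/-- The formula that defines the group operation of `M` defines a group in every elementary
extension. -/
lemma definesGroup_map [Group M] {μ : PFormula L M (Fin 3)}
    (hmul : ∀ a b c : M, μ.Sat ![a, b, c] ↔ a * b = c) (j : M ↪ₑ[L] N) :
    DefinesGroup (xEqX L N) (μ.mapParams j) := by
  have hR : ∀ a b c : M, ternaryRel μ id a b c ↔ a * b = c := hmul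
  have hdom : ∀ x : N, (xEqX L N).Sat fun _ => x := fun x => by
    simp [xEqX, PFormula.Sat]
  have hN := (isCancelGraph_of_sat_iff hmul).map j
  have total : ∀ a b, ∃ c, ternaryRel μ j a b c := fun a b => by
    have := realize_of_forall_realize j (γ := Fin 2) (Formula.iExs Unit
      (subst₃ μ (Sum.inl ∘ Sum.inl) (Sum.inl (Sum.inr 0)) (Sum.inl (Sum.inr 1)) (Sum.inr ())))
      (fun v => by
        simp only [Formula.realize_iExs, realize_subst₃]
        exact ⟨fun _ => v 0 * v 1, (hR _ _ _).2 rfl⟩) ![a, b]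
    simp only [Formula.realize_iExs, realize_subst₃] at this
    obtain ⟨i, hi⟩ := this
    exact ⟨i (), hi⟩
  have assoc : ∀ a b c x y s t, ternaryRel μ j a b x → ternaryRel μ j x c s →
      ternaryRel μ j b c y → ternaryRel μ j a y t → s = t := fun a b c x y s t => by
    have := realize_of_forall_realize j (γ := Fin 7)
      ((subst₃ μ Sum.inl (Sum.inr 0) (Sum.inr 1) (Sum.inr 3)).imp <|
        (subst₃ μ Sum.inl (Sum.inr 3) (Sum.inr 2) (Sum.inr 5)).imp <|
        (subst₃ μ Sum.inl (Sum.inr 1) (Sum.inr 2) (Sum.inr 4)).imp <|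
        (subst₃ μ Sum.inl (Sum.inr 0) (Sum.inr 4) (Sum.inr 6)).imp <|
          (Term.var (Sum.inr 5)).equal (Term.var (Sum.inr 6)))
      (fun v => by
        simp only [Formula.realize_imp, realize_subst₃, Formula.realize_equal, Term.realize_var,
          Sum.elim_comp_inl, hR, Sum.elim_inr]
        intro h₁ h₂ h₃ h₄
        rw [← h₂, ← h₁, ← h₄, ← h₃, mul_assoc]) ![a, b, c, x, y, s, t]
    simp only [Formula.realize_imp, realize_subst₃, Formula.realize_equal, Term.realize_var] at this
    exact this
  have one : ∀ a, ternaryRel μ j (j 1) a a := fun a => by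
    have := realize_of_forall_realize j (γ := Unit)
      (subst₃ μ Sum.inl (Sum.inl 1) (Sum.inr ()) (Sum.inr ()))
      (fun v => by
        rw [realize_subst₃]
        exact (hR _ _ _).2 (one_mul _)) fun _ => a
    rwa [realize_subst₃] at this
  have inv : ∀ a, ∃ b, ternaryRel μ j b a (j 1) := fun a => by
    have := realize_of_forall_realize j (γ := Unit) (Formula.iExs Unit
      (subst₃ μ (Sum.inl ∘ Sum.inl) (Sum.inr ()) (Sum.inl (Sum.inr ())) (Sum.inl (Sum.inl 1))))
      (fun v => by
        simp only [Formula.realize_iExs, realize_subst₃]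
        exact ⟨fun _ => (v ())⁻¹, (hR _ _ _).2 (inv_mul_cancel _)⟩) fun _ => a
    simp only [Formula.realize_iExs, realize_subst₃] at this
    obtain ⟨i, hi⟩ := this
    exact ⟨i (), hi⟩
  have hmap : ∀ a b c : N, (μ.mapParams j).Sat ![a, b, c] ↔ ternaryRel μ j a b c := fun a b c =>
    iff_of_eq (congrFun (congrFun (congrFun (ternaryRel_relabel μ j id) a) b) c)
  obtain ⟨G, hG⟩ := exists_group_of_graph
    (fun a b c : {x : N // (xEqX L N).Sat fun _ => x} => ternaryRel μ j a.1 b.1 c.1)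
    ⟨j 1, hdom _⟩
    (fun a b => let ⟨c, hc⟩ := total a.1 b.1; ⟨⟨c, hdom c⟩, hc⟩)
    (fun a b c c' h h' => Subtype.ext (hN.functional _ _ _ _ h h'))
    (fun a b c x y s t h₁ h₂ h₃ h₄ => Subtype.ext (assoc _ _ _ _ _ _ _ h₁ h₂ h₃ h₄))
    (fun a => one a.1)
    (fun a => let ⟨b, hb⟩ := inv a.1; ⟨⟨b, hdom b⟩, hb⟩)
  exact ⟨G, fun a b c => (hmap _ _ _).trans (hG a b c)⟩

end Quasiminimal

/-! ### The generic type and its definition. -/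

section GenericType

variable {L : FirstOrder.Language.{u, v}} {M : Type w} [L.Structure M]

lemma countable_preimage_equiv_iff {α β : Type*} (e : α ≃ β) (s : Set β) :
    (e ⁻¹' s).Countable ↔ s.Countable :=
  ⟨fun h => by simpa using h.image e, fun h => h.preimage e.injective⟩

lemma IsGenericType.isLeftInvariant [Group M] {p : S₁ L M} (hp : IsGenericType p) :
    IsLeftInvariant p := by
  intro g φ ψ h
  rw [hp φ, hp ψ, ← countable_preimage_equiv_iff (Equiv.mulLeft g)]
  have : {a : M | ψ.Sat fun _ => a}ᶜ = Equiv.mulLeft g ⁻¹' {a | φ.Sat fun _ => a}ᶜ := by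
    ext x
    exact not_congr (h x)
  rw [this]

lemma IsGenericType.isRightInvariant [Group M] {p : S₁ L M} (hp : IsGenericType p) :
    IsRightInvariant p := by
  intro g φ ψ h
  rw [hp φ, hp ψ, ← countable_preimage_equiv_iff (Equiv.mulRight g)]
  have : {a : M | ψ.Sat fun _ => a}ᶜ = Equiv.mulRight g ⁻¹' {a | φ.Sat fun _ => a}ᶜ := by
    ext x
    exact not_congr (h x)
  rw [this]

lemma IsQuasiminimal.exists_isGenericType (hM : IsQuasiminimal L M) :
    ∃ p : S₁ L M, IsGenericType p := by
  have := hM.uncountable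
  refine exists_type_mem_iff (fun X : Set M => Xᶜ.Countable) (fun X hX => ?_)
    (fun φ ψ hφ hψ => ?_) (fun φ => ?_)
  · rw [Set.nonempty_iff_ne_empty]
    rintro rfl
    rw [Set.compl_empty, Set.countable_univ_iff] at hX
    exact not_countable hX
  · rw [Set.compl_inter]
    exact hφ.union hψ
  · rw [compl_compl]
    exact (hM.solutionSet_countable_or φ id).symm

/-- The generic type of a quasiminimal group is definable over `∅`: a definable set is generic if
and only if it has everything as product set with respect to some cancellative operation in the
family that is given by `μ`. -/
lemma IsGenericType.isDefinableOver_empty (hM : IsQuasiminimal L M) {p : S₁ L M}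
    (hp : IsGenericType p) {k : ℕ} {d : Fin k → M} {μ : L.Formula (Fin k ⊕ Fin 3)}
    (hd : IsCancelGraph (ternaryRel μ d)) : IsDefinableOver p ∅ := by
  intro n φ
  rw [Set.empty_definable_iff]
  let μ' : L.Formula ((Fin n ⊕ Fin k) ⊕ Fin 3) := μ.relabel (Sum.map Sum.inr id)
  let φ' : L.Formula ((Fin n ⊕ Fin k) ⊕ Unit) := φ.relabel (Sum.map Sum.inl id)
  -- Other parameters than `d` may define an operation that is not a group, but cancellation alone
  -- forces the criterion to detect co-countability. Hence it is harmless to ask for some good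
  -- parameters.
  refine ⟨Formula.iExs (Fin k) (cancelFormula μ' ⊓ coversFormula μ' φ'), ?_⟩
  ext b
  have hb : Mem (inst φ b) p ↔ (solutionSet φ b)ᶜ.Countable := by
    rw [hp, ← solutionSet_inst φ b]
    rfl
  simp only [Set.mem_ofPred_eq, hb, Formula.realize_iExs, Formula.realize_inf,
    realize_cancelFormula, realize_coversFormula, μ', φ', ternaryRel_relabel, solutionSet_relabel,
    Sum.elim_comp_inl, Sum.elim_comp_inr]
  constructor
  · intro h
    exact ⟨d, hd, (hM.productCovers_iff hd φ b).2 h⟩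
  · rintro ⟨d', hd', h⟩
    exact (hM.productCovers_iff hd' φ b).1 h

variable {N : Type w'} [L.Structure N]

/-- The type over `N` that is defined by the definition of the generic type of `M`. -/
lemma IsQuasiminimal.exists_mem_iff_productCovers (hM : IsQuasiminimal L M) (j : M ↪ₑ[L] N)
    {μ : PFormula L M (Fin 3)} (hR : IsCancelGraph (ternaryRel μ (id : M → M))) :
    ∃ q : S₁ L N, ∀ φ : PFormula L N Unit,
      Mem φ q ↔ ProductCovers (ternaryRel μ j) (solutionSet φ id) := by
  have := hM.uncountable
  refine exists_type_mem_iff _ (fun X hX => ?_)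
    (fun φ ψ hφ hψ => hM.productCovers_inter j hR hφ hψ)
    (fun φ => hM.productCovers_or_compl j hR φ id)
  obtain ⟨x, hx, -⟩ := hX (j (Classical.arbitrary M))
  exact ⟨x, hx⟩

/-! ### The unique heir and its strong regularity. -/

section Heir

variable {j : M ↪ₑ[L] N} {μ : PFormula L M (Fin 3)} {p : S₁ L M} {q : S₁ L N}

lemma IsGenericType.mem_iff_productCovers (hM : IsQuasiminimal L M) (hp : IsGenericType p)
    (hR : IsCancelGraph (ternaryRel μ (id : M → M))) (φ : PFormula L M Unit) :
    Mem φ p ↔ ProductCovers (ternaryRel μ id) (solutionSet φ id) :=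
  (hp φ).trans (hM.productCovers_iff hR φ id).symm

lemma IsGenericType.isHeir (hM : IsQuasiminimal L M) (hp : IsGenericType p)
    (hR : IsCancelGraph (ternaryRel μ (id : M → M)))
    (hq : ∀ φ : PFormula L N Unit,
      Mem φ q ↔ ProductCovers (ternaryRel μ j) (solutionSet φ id)) : IsHeir j p q where
  extends_base φ hφ := by
    rw [hp.mem_iff_productCovers hM hR, ← realize_coversFormula] at hφ
    rw [hq, PFormula.mapParams, solutionSet_relabel, Function.id_comp, ← realize_coversFormula]
    exact (j.map_formula (coversFormula μ φ) id).2 hφ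
  heir n φ c hc := by
    have := hM.uncountable
    by_contra! hn
    simp only [hp.mem_iff_productCovers hM hR, solutionSet_inst] at hn
    rw [hq, solutionSet_inst] at hc
    let μ' : L.Formula ((M ⊕ Fin n) ⊕ Fin 3) := μ.relabel (Sum.map Sum.inl id)
    have key := realize_of_forall_realize j (coversFormula μ' φ).not (by
      intro v
      simpa only [Formula.realize_not, realize_coversFormula, μ', ternaryRel_relabel,
        Sum.elim_comp_inl] using hn v) c
    simp only [Formula.realize_not, realize_coversFormula, μ', ternaryRel_relabel,
        Sum.elim_comp_inl] at key
    exact key hc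

/-- If `q'` contained a non-generic `φ(x, c)`, it would contain `φ(x, c)` together with the
assertion that `φ(·, c)` is non-generic. The heir property would bring this conjunction down to some
`b` in `M`, where a generic set would lie inside a non-generic one. -/
lemma IsGenericType.heir_unique (hM : IsQuasiminimal L M) (hp : IsGenericType p)
    (hR : IsCancelGraph (ternaryRel μ (id : M → M)))
    (hq : ∀ φ : PFormula L N Unit, Mem φ q ↔ ProductCovers (ternaryRel μ j) (solutionSet φ id))
    {q' : S₁ L N} (hq' : IsHeir j p q') : q' = q := by
  have := hM.uncountable
  refine type_ext fun φ hφ => by_contra fun hn => ?_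
  rw [hq] at hn
  obtain ⟨n, c, φ₀, -, -, hφ₀⟩ := exists_finite_params φ N N
  have hsol : solutionSet φ id = solutionSet φ₀ c := by
    ext x
    refine (hφ₀ _).trans (iff_of_eq (congrArg _ ?_))
    ext (i | i) <;> rfl
  let μ' : L.Formula ((M ⊕ Fin n) ⊕ Fin 3) := μ.relabel (Sum.map Sum.inl id)
  let φ' : L.Formula ((M ⊕ Fin n) ⊕ Unit) := φ₀.relabel (Sum.map Sum.inr id)
  -- The second conjunct does not involve `x`: it is a condition on the parameters alone.
  let θ : L.Formula ((M ⊕ Fin n) ⊕ Unit) := φ' ⊓ (coversFormula μ' φ').not.relabel Sum.inl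
  have hmem : Mem (inst θ (Sum.elim j c)) q' := by
    refine hφ.mono fun a ha => ?_
    have ha' : a ∈ solutionSet φ id := ha
    change a ∈ solutionSet (inst θ (Sum.elim j c)) id
    rw [solutionSet_inst, solutionSet_inf]
    refine ⟨?_, ?_⟩
    · rwa [solutionSet_relabel, Sum.elim_comp_inr, ← hsol]
    · rw [solutionSet, Set.mem_ofPred_eq, Formula.realize_relabel, Sum.elim_comp_inl,
        Formula.realize_not, realize_coversFormula, ternaryRel_relabel, solutionSet_relabel,
        Sum.elim_comp_inl, Sum.elim_comp_inr, ← hsol]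
      exact hn
  obtain ⟨b, hb⟩ := hq'.heir n θ c hmem
  rw [hp.mem_iff_productCovers hM hR, solutionSet_inst, solutionSet_inf] at hb
  obtain ⟨x, ⟨-, hx⟩, -⟩ := hb (Classical.arbitrary M)
  rw [solutionSet, Set.mem_ofPred_eq, Formula.realize_relabel, Sum.elim_comp_inl,
    Formula.realize_not, realize_coversFormula, ternaryRel_relabel, Sum.elim_comp_inl] at hx
  exact hx (hb.mono Set.inter_subset_left)

lemma isNonalgebraic_of_mem_iff (hM : IsQuasiminimal L M)
    (hR : IsCancelGraph (ternaryRel μ (id : M → M)))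
    (hq : ∀ φ : PFormula L N Unit, Mem φ q ↔ ProductCovers (ternaryRel μ j) (solutionSet φ id)) :
    IsNonalgebraic q := by
  have := hM.uncountable
  have : Infinite N := Infinite.of_injective j j.injective
  intro φ hφ
  exact (hR.map j).infinite_of_productCovers ((hq φ).1 hφ)

/-- Membership in `q` is expressed by a formula with parameters `d`, and automorphisms fixing `d`
preserve it. -/
lemma isInvariantOver_of_mem_iff {R : N → N → N → Prop} {k : ℕ} {d : Fin k → N}
    {μ₀ : L.Formula (Fin k ⊕ Fin 3)} (hR : ternaryRel μ₀ d = R)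
    (hq : ∀ φ : PFormula L N Unit, Mem φ q ↔ ProductCovers R (solutionSet φ id)) :
    IsInvariantOver q (Set.range d) := by
  intro σ hσ φ
  rw [hq, hq, PFormula.mapParams, solutionSet_relabel, Function.id_comp, ← hR]
  let μ' : L.Formula ((Fin k ⊕ N) ⊕ Fin 3) := μ₀.relabel (Sum.map Sum.inl id)
  let φ' : L.Formula ((Fin k ⊕ N) ⊕ Unit) := φ.relabel (Sum.map Sum.inr id)
  have key := StrongHomClass.realize_formula σ (coversFormula μ' φ') (v := Sum.elim d id)
  have e : σ ∘ Sum.elim d id = Sum.elim d σ := by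
    ext (i | i)
    · exact hσ _ ⟨i, rfl⟩
    · rfl
  simp only [e, realize_coversFormula, μ', φ', ternaryRel_relabel, solutionSet_relabel,
    Sum.elim_comp_inl, Sum.elim_comp_inr] at key
  exact key.symm

lemma realizes_or_restrictEntails (hM : IsQuasiminimal L M)
    (hR : IsCancelGraph (ternaryRel μ (id : M → M)))
    (hq : ∀ φ : PFormula L N Unit, Mem φ q ↔ ProductCovers (ternaryRel μ j) (solutionSet φ id))
    {k : ℕ} {d : Fin k → N} {μ₀ : L.Formula (Fin k ⊕ Fin 3)}
    (hμ₀ : ternaryRel μ₀ d = ternaryRel μ j) {B : Set N} (hB : Set.range d ⊆ B) (a : N) :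
    Realizes a q B ∨ RestrictEntails q B (insert a B) := by
  classical
  have := hM.uncountable
  refine or_iff_not_imp_left.2 fun hreal => ?_
  simp only [Realizes, not_forall] at hreal
  obtain ⟨_, ⟨φ, rfl⟩, hφ, ha⟩ := hreal
  rw [hq, PFormula.mapParams, solutionSet_relabel, Function.id_comp] at hφ
  have hnot : ¬ ProductCovers (ternaryRel μ j) (solutionSet φ.not ((↑) : B → N)) := fun h => by
    obtain ⟨x, ⟨hx, hx'⟩, -⟩ := hM.productCovers_inter j hR hφ h (j (Classical.arbitrary M))
    rw [solutionSet_not] at hx'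
    exact hx' hx
  have ha' : a ∈ solutionSet φ.not ((↑) : B → N) := by
    rw [solutionSet_not]
    intro h
    refine ha ?_
    change a ∈ solutionSet (φ.mapParams Subtype.val) id
    rwa [PFormula.mapParams, solutionSet_relabel]
  refine restrictEntails_of_forall ?_
  rintro _ ⟨ψ, rfl⟩ hψ
  rw [hq, PFormula.mapParams, solutionSet_relabel, Function.id_comp] at hψ
  -- Separates the parameter `a` from those in `B`, so that `ψ` becomes the member at `y = a` of a
  -- family over `B`.
  let f : ↥(insert a B) → B ⊕ Unit := fun x =>
    if h : (x : N) ∈ B then Sum.inl ⟨x, h⟩ else Sum.inr ()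
  have hf : (Sum.elim ((↑) : B → N) fun _ : Unit => a) ∘ f = ((↑) : ↥(insert a B) → N) := by
    ext x
    by_cases h : (x : N) ∈ B
    · simp [f, h]
    · simpa [f, h] using (x.2.resolve_right h).symm
  let ψ' : L.Formula ((B ⊕ Unit) ⊕ Unit) := ψ.relabel (Sum.map f id)
  have hψ' : solutionSet ψ' (Sum.elim ((↑) : B → N) fun _ => a) = solutionSet ψ (↑) := by
    rw [solutionSet_relabel, hf]
  let μB : L.Formula (B ⊕ Fin 3) :=
    μ₀.relabel (Sum.map (fun i => ⟨d i, hB ⟨i, rfl⟩⟩) id)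
  have hμB : ternaryRel μB ((↑) : B → N) = ternaryRel μ j := by
    rw [← hμ₀]
    exact ternaryRel_relabel _ _ _
  -- `χ` holds of the points lying in every generic member of the family indexed by the non-generic
  -- set `φ.not`. Since `a` is one of the indices, `χ` implies `ψ`.
  let χ : PFormula L B Unit := (exceptionFormula μB φ.not ψ').not
  have hχ : solutionSet (χ.mapParams ((↑) : B → N)) id =
      (solutionSet (exceptionFormula μB φ.not ψ') (↑))ᶜ := by
    rw [PFormula.mapParams, solutionSet_relabel, Function.id_comp, solutionSet_not]
  refine ⟨χ.mapParams (↑), ⟨χ, rfl⟩, ?_, ?_⟩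
  · rw [hq, hχ]
    refine (hM.productCovers_or_compl j hR _ _).resolve_left ?_
    rw [solutionSet_exceptionFormula, hμB]
    exact hM.not_productCovers_exception j hR ψ' hnot
  · rw [hχ, solutionSet_exceptionFormula, hμB]
    intro x hx
    by_contra hxψ
    rw [PFormula.mapParams, solutionSet_relabel, Function.id_comp] at hxψ
    exact hx ⟨a, ha', hψ' ▸ hψ, hψ' ▸ hxψ⟩

end Heir

end GenericType

end ModelTypes

theorem theorem5p6 {L : FirstOrder.Language.{u, v}}
    {M : Type w} [L.Structure M] [Group M] (hM : IsQuasiminimal L M)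
    -- the group operation is definable in `M`, with parameters
    (mul : PFormula L M (Fin 3)) (hmul : ∀ a b c : M, mul.Sat ![a, b, c] ↔ a * b = c)
    -- the saturated elementary extension of `M`
    {N : Type w'} [L.Structure N] (j : M ↪ₑ[L] N)
    (κ : Cardinal.{w'}) (hκ : ℵ₀ ≤ κ) (hN : IsSaturated L N κ) :
    ∃ p : S₁ L M, IsGenericType p ∧ IsDefinableOver p ∅ ∧
      IsLeftInvariant p ∧ IsRightInvariant p ∧
      ∃ q : S₁ L N, IsHeir j p q ∧ (∀ q' : S₁ L N, IsHeir j p q' → q' = q) ∧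
        IsRegularGroupWitnessedBy κ (xEqX L N) (mul.mapParams j) q := by
  have hR := isCancelGraph_of_sat_iff hmul
  obtain ⟨p, hp⟩ := hM.exists_isGenericType
  obtain ⟨q, hq⟩ := hM.exists_mem_iff_productCovers j hR
  -- The finitely many parameters `d` of the multiplication serve twice: they are quantified out for
  -- definability over `∅`, and their image in `N` is the small set `A`, finite and so of size below
  -- `κ`.
  obtain ⟨k, d, μ, -, h₁, h₂⟩ := exists_finite_params mul M N
  have hμM : ternaryRel μ d = ternaryRel mul id := by
    ext a b c
    refine ((h₁ _).trans (iff_of_eq (congrArg _ ?_))).symm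
    ext (i | i) <;> rfl
  have hμN : ternaryRel μ (j ∘ d) = ternaryRel mul j := by
    ext a b c
    refine ((h₂ _).trans (iff_of_eq (congrArg _ ?_))).symm
    ext (i | i) <;> rfl
  have hdom : ∀ x : N, (xEqX L N).Sat fun _ => x := fun x => by
    simp [xEqX, PFormula.Sat]
  refine ⟨p, hp, hp.isDefinableOver_empty hM (hμM ▸ hR), hp.isLeftInvariant, hp.isRightInvariant,
    q, hp.isHeir hM hR hq, fun q' hq' => hp.heir_unique hM hR hq hq', definesGroup_map hmul j, ?_⟩
  exact
    { nonalgebraic := isNonalgebraic_of_mem_iff hM hR hq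
      mem := q.mem_of_models (models_toSentence _ hdom)
      regular := ⟨Set.range (j ∘ d),
        (Cardinal.lt_aleph0_iff_set_finite.2 (Set.finite_range _)).trans_le hκ, ⟨xEqX L _, rfl⟩,
        isInvariantOver_of_mem_iff hμN hq,
        fun _ hB a _ => realizes_or_restrictEntails hM hR hq hμN hB a⟩ }
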